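/- Fix a Grothendieck universe $\mathfrak U$ ("small" means $\mathfrak U$-small; all hom-sets are small). Definitions. A collection $T$ of morphisms of a category $C$ is semi-localizing if it contains all identities, is closed under composition, and for all $f_1\colon Y_1\to X$ in $T$ and $f_2\colon Y_2\to X$ in $C$ there are $g_1\colon Z\to Y_1$ and $g_2\colon Z\to Y_2$ with $g_2\in T$ and $f_1g_1=f_2g_2$. Write $\widehat T$ for the collection of morphisms $f\colon Y\to X$ such that $f\circ g\in T$ for some $g\colon Z\to Y$. A Grothendieck topology $J$ on $C$ is an $A$-topology if there is a semi-localizing $T$ such that the covering sieves are exactly the sieves containing a member of $T$. Let $\mathcal T(J)$ be the collection of morphisms $f\colon Y\to X$ such that the sieve of all morphisms to $X$ factoring through $f$ belongs to $J(X)$. The topology is atomic if every cospan in $C$ can be completed to a commutative square and the covering sieves are exactly the nonempty sieves. A morphism $f\colon Y\to X$ is a Galois covering if there are a group $H$ and a homomorphism $\rho\colon H\to \mathrm{Aut}_X(Y)$ such that for every object $Z$, with $H$ acting on $\mathrm{Hom}(Z,Y)$ through $\rho$ by composition, the map $f\circ -\colon \mathrm{Hom}(Z,Y)\to\mathrm{Hom}(Z,X)$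 is a pseudo $H$-torsor: it is $H$-invariant, $H$ acts freely on $\mathrm{Hom}(Z,Y)$, and the induced map $H\backslash\mathrm{Hom}(Z,Y)\to\mathrm{Hom}(Z,X)$ is injective. A site $(C,J)$ is a $B$-site if every morphism of $C$ is an epimorphism, $J$ is an $A$-topology, and a composite $f\circ g$ lies in $\mathcal T(J)$ if and only if $f$ and $g$ both do. A $Y$-site is a $B$-site $(C,J)$ such that (1) $C$ is essentially small; (2) for any two objects $X_1,X_2$ there are an object $Z$ and morphisms $Z\to X_1$, $Z\to X_2$ both in $\mathcal T(J)$; (3) $\widehat{\mathcal T'}=\widehat{\mathcal T(J)}$, where $\mathcal T'$ is the collection of all Galois coverings in $C$. A locally profinite group is a locally compact Hausdorff topological group whose compact open subgroups form a basis of neighbourhoods of the unit; a profinite group is a compact, Hausdorff, totally disconnected topological group. Theorem. Let $(C,J)$ be a $Y$-site with $C$ nonempty, such that $J$ is the atomic topology and $\mathrm{Hom}_C(X,Y)$ is finite for all objects $X,Y$ of $C$. Then there is a locally profinite group $G$ such that the category $\mathrm{Shv}(C,J)$ of sheaves of small sets is equivalent to the category of small discrete sets with continuous left $G$-action and $G$-equivariant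 maps. If moreover $C$ has a final object, then $G$ is profinite. -/

import Mathlib

open CategoryTheory Topology

universe v u

namespace YSites

section Collections

variable {C : Type u} [Category.{v} C]

/-- A collection `T` of morphisms is semi-localizing if it contains the identities, is closed
under composition, and satisfies the Ore condition relative to `T`. -/
structure IsSemiLocalizing (T : MorphismProperty C) : Prop where
  id_mem : ∀ X : C, T (𝟙 X)
  comp_mem : ∀ {Z Y X : C} (g : Z ⟶ Y) (f : Y ⟶ X), T g → T f → T (g ≫ f)
  ore : ∀ {Y₁ Y₂ X : C} (f₁ : Y₁ ⟶ X) (f₂ : Y₂ ⟶ X), T f₁ →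
    ∃ (Z : C) (g₁ : Z ⟶ Y₁) (g₂ : Z ⟶ Y₂), T g₂ ∧ g₁ ≫ f₁ = g₂ ≫ f₂

/-- The saturation of `T`: the morphisms `f : Y ⟶ X` for which some `g : Z ⟶ Y` makes the
composite `Z ⟶ Y ⟶ X` belong to `T`. -/
def saturation (T : MorphismProperty C) : MorphismProperty C :=
  fun Y _ f => ∃ (Z : C) (g : Z ⟶ Y), T (g ≫ f)

/-- `J` is an `A`-topology if, for some semi-localizing collection `T`, the covering sieves are
exactly the sieves that contain a member of `T`. -/
def IsATopology (J : GrothendieckTopology C) : Prop :=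
  ∃ T : MorphismProperty C, IsSemiLocalizing T ∧
    ∀ (X : C) (R : Sieve X), R ∈ J X ↔ ∃ (Y : C) (f : Y ⟶ X), R f ∧ T f

/-- The collection `T(J)` of the morphisms `f` such that the sieve of all morphisms factoring
through `f` is a covering sieve. -/
def coveringMorphisms (J : GrothendieckTopology C) : MorphismProperty C :=
  fun _ X f => Sieve.generate (Presieve.singleton f) ∈ J X

/-- The wide subcategory of `C` with the morphisms in `T` is `Λ`-connected: any two objects
receive morphisms in `T` from a common object. -/
def IsLambdaConnected (T : MorphismProperty C) : Prop :=
  ∀ X Y : C, ∃ (Z : C) (f : Z ⟶ X) (g : Z ⟶ Y), T f ∧ T g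

end Collections

section Galois

/-- A map `φ : S → S'` on a `G`-set `S` is a pseudo `G`-torsor if it is `G`-invariant, `G` acts
freely on `S`, and the induced map on the set of orbits is injective. -/
structure IsPseudoTorsor (G : Type*) [Group G] {S S' : Type*} [MulAction G S] (φ : S → S') :
    Prop where
  map_smul : ∀ (g : G) (s : S), φ (g • s) = φ s
  free : ∀ (g : G) (s : S), g • s = s → g = 1
  injective : ∀ s t : S, φ s = φ t → MulAction.orbitRel G S s t

variable {C : Type u} [Category.{v} C]

/-- Given a homomorphism `ρ` from `G` to the automorphism group of `Y` over `X`, the group `G`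
acts from the left on `Hom(Z, Y)` by composition with `ρ g`. -/
abbrev homAction {X Y : C} (f : Y ⟶ X) {G : Type v} [Group G] (ρ : G →* Aut (Over.mk f)) (Z : C) :
    MulAction G (Z ⟶ Y) where
  smul g h := h ≫ (ρ g).hom.left
  one_smul h := by
    change h ≫ (ρ 1).hom.left = h
    rw [map_one]
    exact Category.comp_id h
  mul_smul g g' h := by
    change h ≫ (ρ (g * g')).hom.left = (h ≫ (ρ g').hom.left) ≫ (ρ g).hom.left
    rw [map_mul, Category.assoc]
    rfl

/-- `f : Y ⟶ X` is a Galois covering if there are a group `G` and a homomorphism from `G` to the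
automorphism group of `Y` over `X` such that, for every object `Z`, composition with `f` is a
pseudo `G`-torsor `Hom(Z, Y) → Hom(Z, X)`.
(Taking `Z = Y` shows that `G` is isomorphic to the automorphism group of `Y` over `X`, so the
universe of `G` imposes no restriction.) -/
def IsGaloisCovering : MorphismProperty C :=
  fun _ _ f => ∃ (G : Type v) (_ : Group G) (ρ : G →* Aut (Over.mk f)), ∀ Z : C,
    letI := homAction f ρ Z
    IsPseudoTorsor G (fun h : Z ⟶ _ => h ≫ f)

/-- `T` has enough Galois coverings if `T` and the collection of all Galois coverings have the
same saturation. -/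
def HasEnoughGaloisCoverings (T : MorphismProperty C) : Prop :=
  saturation (IsGaloisCovering (C := C)) = saturation T

end Galois

section Sites

variable {C : Type u} [Category.{v} C]

/-- `B`-sites: every morphism is an epimorphism, the topology is an `A`-topology, and a composite
belongs to `T(J)` if and only if both factors do. -/
structure IsBSite (J : GrothendieckTopology C) : Prop where
  epi : ∀ {X Y : C} (f : X ⟶ Y), Epi f
  isATopology : IsATopology J
  comp_mem_iff : ∀ {Z Y X : C} (g : Z ⟶ Y) (f : Y ⟶ X),
    coveringMorphisms J (g ≫ f) ↔ coveringMorphisms J f ∧ coveringMorphisms J g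

/-- `Y`-sites, relative to the universe `Type v` in which the morphism sets lie. -/
structure IsYSite (J : GrothendieckTopology C) : Prop extends IsBSite J where
  essentiallySmall : EssentiallySmall.{v} C
  lambdaConnected : IsLambdaConnected (coveringMorphisms J)
  enoughGalois : HasEnoughGaloisCoverings (coveringMorphisms J)

/-- `J` is the atomic topology: `C` satisfies the right Ore condition (every cospan can be
completed to a commutative square) and the covering sieves are the nonempty sieves. -/
def IsAtomicTopology (J : GrothendieckTopology C) : Prop :=
  ∃ hro : GrothendieckTopology.RightOreCondition C, J = GrothendieckTopology.atomic hro

end Sites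

section Groups

variable (G : Type*) [Group G] [TopologicalSpace G]

/-- A locally profinite group is a locally compact Hausdorff topological group whose compact open
subgroups form a basis of neighbourhoods of the unit. -/
structure IsLocallyProfiniteGroup : Prop where
  isTopologicalGroup : IsTopologicalGroup G
  t2Space : T2Space G
  locallyCompactSpace : LocallyCompactSpace G
  hasBasis : (𝓝 (1 : G)).HasBasis
    (fun K : Subgroup G => IsCompact (K : Set G) ∧ IsOpen (K : Set G)) (fun K => (K : Set G))

/-- A profinite group is a compact, Hausdorff, totally disconnected topological group. -/
structure IsProfiniteGroup : Prop where
  isTopologicalGroup : IsTopologicalGroup G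
  compactSpace : CompactSpace G
  t2Space : T2Space G
  totallyDisconnectedSpace : TotallyDisconnectedSpace G

/-- A set with a left `G`-action (and no topology) is a continuous discrete `G`-set if the action
map `G × S → S` is continuous when `S` carries the discrete topology. -/
def IsContinuousDiscrete : ObjectProperty (Action (Type v) G) :=
  fun S =>
    letI : TopologicalSpace S.V := ⊥
    Continuous (fun p : G × S.V => S.ρ p.1 p.2)

/-- The category of discrete sets with continuous left `G`-action and `G`-equivariant maps. -/
abbrev DiscreteGSet : Type _ := (IsContinuousDiscrete.{v} G).FullSubcategory

end Groups

end YSites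

/-!
The finite Galois coverings of a fixed object `X₀` are codirected. Their automorphism groups are
finite and act transitively on the morphisms to them, so a compactness argument makes the
transition morphisms between them functorial, and this pro-object is a point of the atomic site.
Its fibre functor `ω` has finite fibres over `X₀`; by compactness again, the group `G` of
automorphisms of `ω` acts transitively on every fibre, and the stabilizers of points, which form a
basis of neighbourhoods of the unit, are compact over `X₀`. As in Grothendieck's Galois theory, the
sections of a sheaf over `X` are the elements of its fibre fixed by the stabilizer of a point of
`ω.obj X`, which identifies sheaves with discrete `G`-sets.
-/

namespace YSites

section FibreFunctors

universe w

variable {C : Type u} [Category.{v} C] {ω : C ⥤ Type w}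

/-- The fibres over the points of `ω.obj X₀` of the maps induced by the morphisms to `X₀` are
finite. -/
def HasFiniteFibresOver (ω : C ⥤ Type w) (X₀ : C) : Prop :=
  ∀ ⦃Y : C⦄ (f : Y ⟶ X₀) (x : ω.obj X₀), (ω.map f ⁻¹' {x}).Finite

theorem HasFiniteFibresOver.of_hom {X X₀ : C} (hfib : HasFiniteFibresOver ω X₀) (g : X ⟶ X₀) :
    HasFiniteFibresOver ω X := fun _ f x =>
  (hfib (f ≫ g) (ω.map g x)).subset (by rintro _ rfl; simp)

/-- Given two points `x` and `y` of a fibre, this is the relation between the points `z` and `z'`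
of any other fibre that `(z, z')` and `(x, y)` come from the same pair of points of a third fibre.
It contains the graph of every endomorphism of `ω` taking `x` to `y`. -/
def linkedPoints {X : C} (x y : ω.obj X) : Subfunctor (CategoryOfElements.π ω ⋙ ω) where
  obj e := {z' | ∃ (W : C) (w w' : ω.obj W) (f : W ⟶ e.1) (h : W ⟶ X),
    ω.map f w = e.2 ∧ ω.map f w' = z' ∧ ω.map h w = x ∧ ω.map h w' = y}
  map := by
    rintro e e' ⟨g, hg⟩ _ ⟨W, w, w', f, h, hw, rfl, hx, hy⟩
    exact ⟨W, w, w', f ≫ g, h, by rw [Functor.map_comp_apply, hw, hg],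
      Functor.map_comp_apply .., hx, hy⟩

variable [IsCofiltered ω.Elements]

theorem exists_map_eq_and_map_eq {X Y : C} (x : ω.obj X) (y : ω.obj Y) :
    ∃ (Z : C) (z : ω.obj Z) (f : Z ⟶ X) (g : Z ⟶ Y), ω.map f z = x ∧ ω.map g z = y := by
  let a : ω.Elements := ⟨X, x⟩
  let b : ω.Elements := ⟨Y, y⟩
  exact ⟨(IsCofiltered.min a b).1, (IsCofiltered.min a b).2, (IsCofiltered.minToLeft a b).1,
    (IsCofiltered.minToRight a b).1, (IsCofiltered.minToLeft a b).2,
    (IsCofiltered.minToRight a b).2⟩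

theorem nonempty_linkedPoints (hsurj : ∀ {X Y : C} (f : X ⟶ Y), Function.Surjective (ω.map f))
    {X : C} (x y : ω.obj X) (e : ω.Elements) : ((linkedPoints x y).obj e).Nonempty := by
  obtain ⟨W, w, f, h, hf, hh⟩ := exists_map_eq_and_map_eq e.2 x
  obtain ⟨w', hw'⟩ := hsurj h y
  exact ⟨ω.map f w', W, w, w', f, h, hf, rfl, hh, hw'⟩

variable [∀ {X Y : C} (f : X ⟶ Y), Epi f]

theorem eq_of_map_apply_eq {X Y : C} {f g : X ⟶ Y} {x : ω.obj X}
    (h : ω.map f x = ω.map g x) : f = g := by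
  let a : ω.Elements := ⟨X, x⟩
  let b : ω.Elements := ⟨Y, ω.map g x⟩
  let p : a ⟶ b := ⟨f, h⟩
  let q : a ⟶ b := ⟨g, rfl⟩
  have : (IsCofiltered.eqHom p q).1 ≫ f = (IsCofiltered.eqHom p q).1 ≫ g :=
    congrArg Subtype.val (IsCofiltered.eq_condition p q)
  exact (cancel_epi _).1 this

theorem injective_app (η : ω ⟶ ω) (X : C) : Function.Injective (η.app X) := by
  intro x y h
  obtain ⟨Z, z, f, g, rfl, rfl⟩ := exists_map_eq_and_map_eq x y
  rw [NatTrans.naturality_apply, NatTrans.naturality_apply] at h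
  rw [eq_of_map_apply_eq h]

theorem finite_linkedPoints (hsurj : ∀ {X Y : C} (f : X ⟶ Y), Function.Surjective (ω.map f))
    {X : C} (hfib : HasFiniteFibresOver ω X) (x y : ω.obj X)
    (e : ω.Elements) : ((linkedPoints x y).obj e).Finite := by
  obtain ⟨W, w, f, h, hf, hh⟩ := exists_map_eq_and_map_eq e.2 x
  refine ((hfib h y).image (ω.map f)).subset ?_
  rintro _ ⟨W', v, v', f', h', hf', rfl, hh', rfl⟩
  obtain ⟨V, u, a, b, rfl, rfl⟩ := exists_map_eq_and_map_eq w v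
  obtain ⟨u', rfl⟩ := hsurj b v'
  have hfV : a ≫ f = b ≫ f' := eq_of_map_apply_eq (x := u) (by simp [hf, hf'])
  have hhV : a ≫ h = b ≫ h' := eq_of_map_apply_eq (x := u) (by simp [hh, hh'])
  exact ⟨ω.map a u', by
      rw [Set.mem_preimage, Set.mem_singleton_iff, ← Functor.map_comp_apply, hhV,
        Functor.map_comp_apply],
    by
      rw [← Functor.map_comp_apply, hfV, Functor.map_comp_apply]⟩

theorem exists_endomorphism_apply_eq_of_hasFiniteFibresOver
    (hsurj : ∀ {X Y : C} (f : X ⟶ Y), Function.Surjective (ω.map f))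
    {X : C} (hfib : HasFiniteFibresOver ω X) (x y : ω.obj X) : ∃ η : ω ⟶ ω, η.app X x = y := by
  have (e : ω.Elements) : Nonempty ((linkedPoints x y).toFunctor.obj e) :=
    (nonempty_linkedPoints hsurj x y e).to_subtype
  have (e : ω.Elements) : Finite ((linkedPoints x y).toFunctor.obj e) :=
    (finite_linkedPoints hsurj hfib x y e).to_subtype
  obtain ⟨s, hs⟩ := nonempty_sections_of_finite_cofiltered_system (linkedPoints x y).toFunctor
  refine ⟨{ app := fun Z => ↾fun z => (s ⟨Z, z⟩).1, naturality := fun Z Z' f => ?_ }, ?_⟩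
  · ext z
    exact (congrArg Subtype.val
      (hs (CategoryOfElements.homMk ⟨Z, z⟩ ⟨Z', ω.map f z⟩ f rfl))).symm
  · obtain ⟨W, w, w', f, h, hw, hz, hx, hy⟩ := (s ⟨X, x⟩).2
    have : f = h := eq_of_map_apply_eq (hw.trans hx.symm)
    exact hz.symm.trans (this ▸ hy)

theorem exists_endomorphism_apply_eq
    (hsurj : ∀ {X Y : C} (f : X ⟶ Y), Function.Surjective (ω.map f))
    {X₀ : C} (hfib : HasFiniteFibresOver ω X₀) (x₀ : ω.obj X₀) {X : C} (x y : ω.obj X) :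
    ∃ η : ω ⟶ ω, η.app X x = y := by
  obtain ⟨W, w, f, g, rfl, -⟩ := exists_map_eq_and_map_eq x x₀
  obtain ⟨w', rfl⟩ := hsurj f y
  obtain ⟨η, rfl⟩ := exists_endomorphism_apply_eq_of_hasFiniteFibresOver hsurj (hfib.of_hom g) w w'
  exact ⟨η, NatTrans.naturality_apply ..⟩

theorem isIso_of_apply_eq
    {X₀ : C} (hfib : HasFiniteFibresOver ω X₀) {x₀ : ω.obj X₀} {η : ω ⟶ ω}
    (hη : η.app X₀ x₀ = x₀) : IsIso η := by
  suffices ∀ X, IsIso (η.app X) from NatIso.isIso_of_isIso_app η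
  refine fun X => (isIso_iff_bijective _).2 ⟨injective_app η X, fun x => ?_⟩
  obtain ⟨W, w, f, g, rfl, hg⟩ := exists_map_eq_and_map_eq x x₀
  have hmaps : Set.MapsTo (η.app W) (ω.map g ⁻¹' {x₀}) (ω.map g ⁻¹' {x₀}) := fun v hv => by
    rw [Set.mem_preimage, Set.mem_singleton_iff] at hv ⊢
    rw [← NatTrans.naturality_apply, hv, hη]
  obtain ⟨v, -, rfl⟩ :=
    (((hfib g x₀).injOn_iff_bijOn_of_mapsTo hmaps).1 (injective_app η W).injOn).surjOn hg
  exact ⟨ω.map f v, NatTrans.naturality_apply ..⟩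

theorem isIso_endomorphism
    (hsurj : ∀ {X Y : C} (f : X ⟶ Y), Function.Surjective (ω.map f))
    {X₀ : C} (hfib : HasFiniteFibresOver ω X₀) (x₀ : ω.obj X₀) (η : ω ⟶ ω) : IsIso η := by
  obtain ⟨κ, hκ⟩ := exists_endomorphism_apply_eq hsurj hfib x₀ (η.app X₀ x₀) x₀
  have hκη : IsIso (η ≫ κ) := isIso_of_apply_eq hfib hκ
  have hηκ : IsIso (κ ≫ η) := isIso_of_apply_eq hfib (x₀ := η.app X₀ x₀)
    (congrArg (η.app X₀) hκ)
  have : Mono η := mono_of_mono η κ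
  have : IsSplitEpi η := ⟨⟨inv (κ ≫ η) ≫ κ, by simp⟩⟩
  exact isIso_of_mono_of_isSplitEpi η

end FibreFunctors

section FundamentalGroup

universe w

variable {C : Type u} [Category.{v} C] [EssentiallySmall.{w} C] (ω : C ⥤ Type w)

instance small_aut : Small.{w} (Aut ω) :=
  have : LocallySmall.{w} (C ⥤ Type w) :=
    locallySmall_of_faithful (equivSmallModel.{w} C).congrLeft.functor
  small_of_injective (f := fun α : Aut ω => α.hom) fun _ _ h => Iso.ext h

/-- The fundamental group of `C` at a fibre functor `ω`: a copy of the automorphism group of `ω`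
in the universe of the fibres. -/
def FundamentalGroup : Type w :=
  Shrink.{w} (Aut ω)

namespace FundamentalGroup

noncomputable instance : Group (FundamentalGroup ω) :=
  inferInstanceAs (Group (Shrink.{w} (Aut ω)))

/-- The identification of the fundamental group with the automorphism group of the fibre
functor. -/
noncomputable def equivAut : FundamentalGroup ω ≃* Aut ω :=
  Shrink.mulEquiv

variable {ω}

noncomputable instance (X : C) : MulAction (FundamentalGroup ω) (ω.obj X) where
  smul g x := (equivAut ω g).hom.app X x
  one_smul x := by
    change (equivAut ω 1).hom.app X x = x
    rw [map_one]
    rfl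
  mul_smul g h x := by
    change (equivAut ω (g * h)).hom.app X x = _
    rw [map_mul]
    rfl

theorem smul_def (g : FundamentalGroup ω) {X : C} (x : ω.obj X) :
    g • x = (equivAut ω g).hom.app X x :=
  rfl

theorem map_smul (g : FundamentalGroup ω) {X Y : C} (f : X ⟶ Y) (x : ω.obj X) :
    ω.map f (g • x) = g • ω.map f x :=
  (NatTrans.naturality_apply (equivAut ω g).hom f x).symm

variable (ω) in
/-- The equivariant map of fibres induced by a morphism. -/
noncomputable def mapHom {X Y : C} (f : X ⟶ Y) : ω.obj X →[FundamentalGroup ω] ω.obj Y :=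
  ⟨ω.map f, fun g x => map_smul g f x⟩

theorem eq_one_of_forall_smul_eq {g : FundamentalGroup ω}
    (h : ∀ (X : C) (x : ω.obj X), g • x = x) : g = 1 :=
  (equivAut ω).injective <| by
    rw [map_one]
    ext X x
    exact h X x

theorem exists_forall_smul_eq (η : ω ⟶ ω) [IsIso η] :
    ∃ g : FundamentalGroup ω, ∀ (X : C) (x : ω.obj X), g • x = η.app X x :=
  have ⟨g, hg⟩ := (equivAut ω).surjective (asIso η)
  ⟨g, fun X x => by rw [smul_def, hg]; rfl⟩

section Topology

variable [IsCofiltered ω.Elements]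

variable (ω) in
/-- The stabilizers of the points of the fibres form a filter basis at the unit, because any two
points are the images of a third. -/
noncomputable abbrev stabilizerBasis : GroupFilterBasis (FundamentalGroup ω) where
  sets := {U | ∃ (X : C) (x : ω.obj X), U = MulAction.stabilizer (FundamentalGroup ω) x}
  nonempty :=
    have ⟨X, x⟩ := (IsCofiltered.nonempty : Nonempty ω.Elements).some
    ⟨_, X, x, rfl⟩
  inter_sets := by
    rintro _ _ ⟨X, x, rfl⟩ ⟨Y, y, rfl⟩
    obtain ⟨Z, z, f, g, rfl, rfl⟩ := exists_map_eq_and_map_eq x y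
    refine ⟨_, ⟨Z, z, rfl⟩, fun a (ha : a • z = z) => ⟨?_, ?_⟩⟩
    · exact (map_smul a f z).symm.trans (congrArg _ ha)
    · exact (map_smul a g z).symm.trans (congrArg _ ha)
  one' := by
    rintro _ ⟨X, x, rfl⟩
    exact one_mem _
  mul' := by
    rintro U hU
    obtain ⟨X, x, rfl⟩ := id hU
    exact ⟨_, hU, (coe_mul_coe _).subset⟩
  inv' := by
    rintro U hU
    obtain ⟨X, x, rfl⟩ := id hU
    exact ⟨_, hU, fun _ => inv_mem⟩
  conj' := by
    rintro g _ ⟨X, x, rfl⟩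
    refine ⟨_, ⟨X, g⁻¹ • x, rfl⟩, fun a ha => ?_⟩
    rw [SetLike.mem_coe, MulAction.mem_stabilizer_iff] at ha
    simp [mul_smul, ha]

noncomputable instance : TopologicalSpace (FundamentalGroup ω) :=
  (stabilizerBasis ω).topology

instance : IsTopologicalGroup (FundamentalGroup ω) :=
  (stabilizerBasis ω).isTopologicalGroup

theorem stabilizer_mem_nhds_one {X : C} (x : ω.obj X) :
    (MulAction.stabilizer (FundamentalGroup ω) x : Set (FundamentalGroup ω)) ∈ 𝓝 1 :=
  (stabilizerBasis ω).mem_nhds_one ⟨X, x, rfl⟩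

theorem exists_stabilizer_subset {U : Set (FundamentalGroup ω)} (hU : U ∈ 𝓝 1) :
    ∃ (X : C) (x : ω.obj X), (MulAction.stabilizer (FundamentalGroup ω) x : Set _) ⊆ U := by
  obtain ⟨_, ⟨X, x, rfl⟩, h⟩ := (stabilizerBasis ω).nhds_one_hasBasis.mem_iff.1 hU
  exact ⟨X, x, h⟩

theorem isOpen_stabilizer {X : C} (x : ω.obj X) :
    IsOpen (MulAction.stabilizer (FundamentalGroup ω) x : Set (FundamentalGroup ω)) :=
  Subgroup.isOpen_of_mem_nhds _ (stabilizer_mem_nhds_one x)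

instance : NonarchimedeanGroup (FundamentalGroup ω) where
  is_nonarchimedean U hU := by
    obtain ⟨X, x, h⟩ := exists_stabilizer_subset hU
    exact ⟨⟨MulAction.stabilizer _ x, isOpen_stabilizer x⟩, h⟩

instance : T2Space (FundamentalGroup ω) :=
  ((stabilizerBasis ω).t2Space_iff_sInter_subset rfl).2 fun _ hg =>
    eq_one_of_forall_smul_eq fun X x => hg _ ⟨X, x, rfl⟩

theorem finite_image_smul_stabilizer {X₀ : C} (hfib : HasFiniteFibresOver ω X₀) (x₀ : ω.obj X₀)
    {Y : C} (y : ω.obj Y) :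
    ((· • y) '' (MulAction.stabilizer (FundamentalGroup ω) x₀ :
      Set (FundamentalGroup ω))).Finite := by
  obtain ⟨Z, z, f, g, rfl, rfl⟩ := exists_map_eq_and_map_eq x₀ y
  refine ((hfib f (ω.map f z)).image (ω.map g)).subset ?_
  rintro _ ⟨a, ha, rfl⟩
  exact ⟨a • z, (map_smul a f z).trans ha, map_smul a g z⟩

theorem le_nhds_of_eventually_smul_eq {l : Filter (FundamentalGroup ω)} {g : FundamentalGroup ω}
    (h : ∀ (X : C) (x : ω.obj X), ∀ᶠ a in l, a • x = g • x) : l ≤ 𝓝 g := by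
  intro U hU
  rw [← map_mul_left_nhds_one g] at hU
  obtain ⟨X, x, hx⟩ := exists_stabilizer_subset hU
  filter_upwards [h X x] with a ha
  have : g⁻¹ * a ∈ MulAction.stabilizer (FundamentalGroup ω) x := by
    rw [MulAction.mem_stabilizer_iff, mul_smul, ha, inv_smul_smul]
  simpa using hx this

variable [∀ {X Y : C} (f : X ⟶ Y), Epi f]
  (hsurj : ∀ {X Y : C} (f : X ⟶ Y), Function.Surjective (ω.map f))
  {X₀ : C} (hfib : HasFiniteFibresOver ω X₀) (x₀ : ω.obj X₀)

include hsurj hfib x₀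

theorem isPretransitive (X : C) : MulAction.IsPretransitive (FundamentalGroup ω) (ω.obj X) where
  exists_smul_eq x y := by
    obtain ⟨η, rfl⟩ := exists_endomorphism_apply_eq hsurj hfib x₀ x y
    have := isIso_endomorphism hsurj hfib x₀ η
    obtain ⟨g, hg⟩ := exists_forall_smul_eq η
    exact ⟨g, hg X x⟩

theorem isCompact_stabilizer :
    IsCompact (MulAction.stabilizer (FundamentalGroup ω) x₀ : Set (FundamentalGroup ω)) := by
  refine isCompact_iff_ultrafilter_le_nhds.2 fun U hU => ?_
  rw [Filter.le_principal_iff] at hU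
  have hlim (Y : C) (y : ω.obj Y) : ∃ y', ∀ᶠ a : FundamentalGroup ω in U, a • y = y' := by
    have hfin := finite_image_smul_stabilizer hfib x₀ y
    obtain ⟨y', -, hy'⟩ :=
      (Ultrafilter.eventually_exists_mem_iff (P := fun y' a => a • y = y') hfin).1
        (Filter.mem_of_superset hU fun a ha => ⟨a • y, ⟨a, ha, rfl⟩, rfl⟩)
    exact ⟨y', hy'⟩
  choose lim hlim using hlim
  let η : ω ⟶ ω :=
    { app := fun Y => ↾lim Y
      naturality := fun Y Y' f => by
        ext y
        obtain ⟨a, ha, ha'⟩ := ((hlim Y y).and (hlim Y' (ω.map f y))).exists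
        exact ha'.symm.trans ((map_smul a f y).symm.trans (congrArg _ ha)) }
  have := isIso_endomorphism hsurj hfib x₀ η
  obtain ⟨g, hg⟩ := exists_forall_smul_eq η
  have hUg (Y : C) (y : ω.obj Y) : ∀ᶠ a : FundamentalGroup ω in U, a • y = g • y :=
    (hlim Y y).mono fun a ha => ha.trans (hg Y y).symm
  obtain ⟨a, ha, ha'⟩ := ((hUg X₀ x₀).and hU).exists
  exact ⟨g, ha.symm.trans ha', le_nhds_of_eventually_smul_eq hUg⟩

end Topology

end FundamentalGroup

end FundamentalGroup

theorem isLocallyProfiniteGroup_of_isCompact_of_isOpen {G : Type*} [Group G] [TopologicalSpace G]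
    [NonarchimedeanGroup G] [T2Space G] {K : Subgroup G} (hK : IsCompact (K : Set G))
    (hK' : IsOpen (K : Set G)) : IsLocallyProfiniteGroup G where
  isTopologicalGroup := inferInstance
  t2Space := inferInstance
  locallyCompactSpace :=
    hK.locallyCompactSpace_of_mem_nhds_of_group (hK'.mem_nhds (one_mem K))
  hasBasis := by
    refine ⟨fun U => ⟨fun hU => ?_, fun ⟨V, hV, hVU⟩ =>
      Filter.mem_of_superset (hV.2.mem_nhds (one_mem V)) hVU⟩⟩
    obtain ⟨V, hV⟩ := NonarchimedeanGroup.is_nonarchimedean U hU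
    exact ⟨K ⊓ V, ⟨hK.inter_right V.isClosed, hK'.inter V.isOpen⟩,
      Set.inter_subset_right.trans hV⟩

theorem isProfiniteGroup_of_compactSpace (G : Type*) [Group G] [TopologicalSpace G]
    [NonarchimedeanGroup G] [T2Space G] [CompactSpace G] : IsProfiniteGroup G where
  isTopologicalGroup := inferInstance
  compactSpace := inferInstance
  t2Space := inferInstance
  totallyDisconnectedSpace := inferInstance

section AtomicTopology

universe w

open Opposite

variable {C : Type u} [Category.{v} C] {J : GrothendieckTopology C}

theorem IsAtomicTopology.rightOreCondition (hJ : IsAtomicTopology J) :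
    GrothendieckTopology.RightOreCondition C :=
  hJ.1

theorem IsAtomicTopology.mem_iff (hJ : IsAtomicTopology J) {X : C} {R : Sieve X} :
    R ∈ J X ↔ ∃ (Y : C) (f : Y ⟶ X), R f := by
  obtain ⟨hro, rfl⟩ := hJ
  exact Iff.rfl

theorem IsAtomicTopology.coveringMorphisms (hJ : IsAtomicTopology J) {X Y : C} (f : Y ⟶ X) :
    YSites.coveringMorphisms J f :=
  hJ.mem_iff.2 ⟨Y, f, Y, 𝟙 Y, f, Presieve.singleton_self f, Category.id_comp f⟩

theorem surjective_fiber_map (Φ : GrothendieckTopology.Point.{w} J) {X Y : C} {f : Y ⟶ X}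
    (hf : coveringMorphisms J f) : Function.Surjective (Φ.fiber.map f) := fun x => by
  obtain ⟨Z, _, ⟨_, g, _, ⟨⟩, rfl⟩, z, rfl⟩ := Φ.jointly_surjective _ hf x
  exact ⟨Φ.fiber.map g z, (Functor.map_comp_apply ..).symm⟩

theorem nonempty_fiber_obj (Φ : GrothendieckTopology.Point.{w} J)
    (hconn : IsLambdaConnected (coveringMorphisms J)) (X : C) : Nonempty (Φ.fiber.obj X) := by
  obtain ⟨Y, y⟩ := (IsCofiltered.nonempty : Nonempty Φ.fiber.Elements).some
  obtain ⟨Z, f, g, -, hg⟩ := hconn X Y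
  obtain ⟨z, -⟩ := surjective_fiber_map Φ hg y
  exact ⟨Φ.fiber.map f z⟩

variable {P : Cᵒᵖ ⥤ Type w}

theorem injective_map_of_isSheafFor_singleton {X Y : C} {f : Y ⟶ X}
    (hf : Presieve.IsSheafFor P (Presieve.singleton f)) : Function.Injective (P.map f.op) :=
  fun s t h => hf.isSeparatedFor.ext fun _ _ hg => by
    cases hg
    exact h

theorem IsAtomicTopology.isSheaf_iff (hJ : IsAtomicTopology J) :
    Presieve.IsSheaf J P ↔
      ∀ {X Y : C} (f : Y ⟶ X), Presieve.IsSheafFor P (Presieve.singleton f) := by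
  refine ⟨fun hP X Y f =>
    (Presieve.isSheafFor_iff_generate _).2 (hP _ (hJ.coveringMorphisms f)), fun hP X R hR => ?_⟩
  obtain ⟨Y, f, hf⟩ := hJ.mem_iff.1 hR
  refine Presieve.isSheafFor_subsieve_aux P (S := Sieve.generate (Presieve.singleton f))
    ?_ ((Presieve.isSheafFor_iff_generate _).1 (hP f)) fun Z g _ => ?_
  · rintro _ _ ⟨_, _, _, ⟨⟩, rfl⟩
    exact R.downward_closed hf _
  · obtain ⟨W, a, b, hab⟩ := hJ.rightOreCondition f g
    intro x s t hs ht
    have hb : (Sieve.generate (Presieve.singleton f)).pullback g b :=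
      ⟨_, a, f, Presieve.singleton_self f, hab⟩
    exact injective_map_of_isSheafFor_singleton (hP b) ((hs b hb).trans (ht b hb).symm)

variable (hJ : IsAtomicTopology J) (hP : Presieve.IsSheaf J P)

include hJ hP

theorem IsAtomicTopology.injective_map {X Y : C} (f : Y ⟶ X) : Function.Injective (P.map f.op) :=
  injective_map_of_isSheafFor_singleton (hJ.isSheaf_iff.1 hP f)

theorem IsAtomicTopology.exists_map_eq {X Y : C} (f : Y ⟶ X) (s : P.obj (op Y))
    (hs : ∀ {Z : C} (a b : Z ⟶ Y), a ≫ f = b ≫ f → P.map a.op s = P.map b.op s) :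
    ∃ t, P.map f.op t = s :=
  (Presieve.isSheafFor_singleton.1 (hJ.isSheaf_iff.1 hP f) s hs).exists

theorem IsAtomicTopology.injective_toPresheafFiber [LocallySmall.{w} C]
    (Φ : GrothendieckTopology.Point.{w} J) {X : C} (x : Φ.fiber.obj X) :
    Function.Injective (Φ.toPresheafFiber X x P) := fun s t h => by
  obtain ⟨Y, f, -, -, h'⟩ := (Φ.toPresheafFiber_eq_iff' (P := P) X x s t).1 h
  exact hJ.injective_map hP f h'

end AtomicTopology

theorem isContinuousDiscrete_iff {G : Type*} [Group G] [TopologicalSpace G] [IsTopologicalGroup G]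
    (S : Action (Type v) G) :
    IsContinuousDiscrete G S ↔ ∀ s : S.V, IsOpen {g : G | S.ρ g s = s} := by
  let _ : MulAction G S.V := inferInstanceAs (MulAction G (ToType S))
  let _ : TopologicalSpace S.V := ⊥
  have : DiscreteTopology S.V := ⟨rfl⟩
  exact ⟨fun h => continuousSMul_iff_stabilizer_isOpen.1 ⟨h⟩,
    fun h => (continuousSMul_iff_stabilizer_isOpen.2 h).continuous_smul⟩

section MulActionHom

variable {G X Y S : Type*}

theorem existsUnique_mulActionHom_comp_eq [SMul G X] [SMul G Y] [SMul G S] {π : X →[G] Y}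
    (hπ : Function.Surjective π) {φ : X →[G] S} (hφ : ∀ x x', π x = π x' → φ x = φ x') :
    ∃! ψ : Y →[G] S, ψ.comp π = φ := by
  choose l hl using hπ
  refine ⟨⟨fun y => φ (l y), fun g y => ?_⟩, MulActionHom.ext fun x => hφ _ _ (hl _), ?_⟩
  · rw [id, ← map_smul]
    exact hφ _ _ (by rw [hl, map_smul, hl])
  · rintro ψ rfl
    exact MulActionHom.ext fun y => congrArg ψ (hl y).symm

theorem exists_mulActionHom_apply_eq [Group G] [MulAction G X] [MulAction G S]
    [MulAction.IsPretransitive G X] {x : X} {s : S}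
    (h : MulAction.stabilizer G x ≤ MulAction.stabilizer G s) : ∃ φ : X →[G] S, φ x = s := by
  obtain ⟨φ, hφ, -⟩ := existsUnique_mulActionHom_comp_eq
    (π := (⟨(· • x), fun g k => mul_smul g k x⟩ : G →[G] X))
    (φ := (⟨(· • s), fun g k => mul_smul g k s⟩ : G →[G] S))
    (MulAction.surjective_smul G x) fun g k hgk => by
      have : k⁻¹ * g ∈ MulAction.stabilizer G s :=
        h (MulAction.mem_stabilizer_iff.2 (by rw [mul_smul, inv_smul_eq_iff]; exact hgk))
      rwa [MulAction.mem_stabilizer_iff, mul_smul, inv_smul_eq_iff] at this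
  refine ⟨φ, ?_⟩
  calc
    φ x = φ ((1 : G) • x) := by rw [one_smul]
    _ = (1 : G) • s := DFunLike.congr_fun hφ 1
    _ = s := one_smul G s

end MulActionHom

section FibresOfSheaves

universe w

open Opposite

variable {C : Type u} [Category.{v} C] [EssentiallySmall.{w} C] {J : GrothendieckTopology C}
  (Φ : GrothendieckTopology.Point.{w} J)

noncomputable instance (P : Cᵒᵖ ⥤ Type w) :
    SMul (FundamentalGroup Φ.fiber) (Φ.presheafFiber.obj P) where
  smul g := Φ.presheafFiberDesc (fun X x => Φ.toPresheafFiber X (g • x) P) fun X Y f x => by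
    rw [← FundamentalGroup.map_smul, Φ.toPresheafFiber_w]

theorem smul_toPresheafFiber_apply (g : FundamentalGroup Φ.fiber) {X : C} (x : Φ.fiber.obj X)
    {P : Cᵒᵖ ⥤ Type w} (s : P.obj (op X)) :
    g • Φ.toPresheafFiber X x P s = Φ.toPresheafFiber X (g • x) P s :=
  ConcreteCategory.congr_hom (Φ.toPresheafFiber_presheafFiberDesc (P := P)
    (fun X x => Φ.toPresheafFiber X (g • x) P) _ X x) s

noncomputable instance (P : Cᵒᵖ ⥤ Type w) :
    MulAction (FundamentalGroup Φ.fiber) (Φ.presheafFiber.obj P) where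
  one_smul t := by
    obtain ⟨X, x, s, rfl⟩ := Φ.toPresheafFiber_jointly_surjective (P := P) t
    rw [smul_toPresheafFiber_apply, one_smul]
  mul_smul g h t := by
    obtain ⟨X, x, s, rfl⟩ := Φ.toPresheafFiber_jointly_surjective (P := P) t
    simp only [smul_toPresheafFiber_apply, mul_smul]

theorem smul_presheafFiber_map_apply (g : FundamentalGroup Φ.fiber) {P Q : Cᵒᵖ ⥤ Type w}
    (α : P ⟶ Q) (t : Φ.presheafFiber.obj P) :
    Φ.presheafFiber.map α (g • t) = g • Φ.presheafFiber.map α t := by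
  obtain ⟨X, x, s, rfl⟩ := Φ.toPresheafFiber_jointly_surjective (P := P) t
  simp only [smul_toPresheafFiber_apply, Φ.toPresheafFiber_naturality_apply]

theorem isContinuousDiscrete_presheafFiber (P : Cᵒᵖ ⥤ Type w) :
    IsContinuousDiscrete _
      (Action.ofMulAction (FundamentalGroup Φ.fiber) (Φ.presheafFiber.obj P)) := by
  refine (isContinuousDiscrete_iff _).2 fun t => ?_
  obtain ⟨X, x, s, rfl⟩ := Φ.toPresheafFiber_jointly_surjective (P := P) t
  refine Subgroup.isOpen_mono (H₁ := MulAction.stabilizer _ x)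
    (H₂ := MulAction.stabilizer _ (Φ.toPresheafFiber X x P s))
    (fun g hg => ?_) (FundamentalGroup.isOpen_stabilizer x)
  rw [MulAction.mem_stabilizer_iff] at hg ⊢
  rw [smul_toPresheafFiber_apply, hg]

/-- The fibre functor on sheaves at a point of the site, with values in the discrete sets with a
continuous action of the fundamental group. -/
noncomputable def sheafFiberGSet :
    Sheaf J (Type w) ⥤ DiscreteGSet.{w} (FundamentalGroup Φ.fiber) where
  obj F := ⟨_, isContinuousDiscrete_presheafFiber Φ F.obj⟩
  map {F F'} α := ObjectProperty.homMk
    { hom := Φ.presheafFiber.map α.hom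
      comm g := by
        ext t
        exact smul_presheafFiber_map_apply Φ g α.hom t }
  map_id F := by
    ext t
    exact ConcreteCategory.congr_hom (Φ.presheafFiber.map_id F.obj) t
  map_comp {F F' F''} α β := by
    ext t
    exact ConcreteCategory.congr_hom (Φ.presheafFiber.map_comp α.hom β.hom) t

section

variable (hJ : IsAtomicTopology J)

include hJ

theorem faithful_sheafFiberGSet [∀ X, Nonempty (Φ.fiber.obj X)] : (sheafFiberGSet Φ).Faithful where
  map_injective {F F'} α β h := by
    ext ⟨X⟩ s
    obtain ⟨x⟩ : Nonempty (Φ.fiber.obj X) := inferInstance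
    have h' : Φ.presheafFiber.map α.hom = Φ.presheafFiber.map β.hom :=
      congrArg (fun φ => φ.hom.hom) h
    refine hJ.injective_toPresheafFiber ((isSheaf_iff_isSheaf_of_type J _).1 F'.property) Φ x ?_
    exact (Φ.toPresheafFiber_naturality_apply α.hom X x s).symm.trans
      ((ConcreteCategory.congr_hom h' _).trans (Φ.toPresheafFiber_naturality_apply β.hom X x s))

variable [∀ X, MulAction.IsPretransitive (FundamentalGroup Φ.fiber) (Φ.fiber.obj X)]
  [∀ X, Nonempty (Φ.fiber.obj X)]

theorem exists_toPresheafFiber_apply_eq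
    {P : Cᵒᵖ ⥤ Type w} (hP : Presieve.IsSheaf J P) {X : C} (x : Φ.fiber.obj X)
    {t : Φ.presheafFiber.obj P}
    (ht : MulAction.stabilizer (FundamentalGroup Φ.fiber) x ≤ MulAction.stabilizer _ t) :
    ∃ s, Φ.toPresheafFiber X x P s = t := by
  obtain ⟨Y, y, s, rfl⟩ := Φ.toPresheafFiber_jointly_surjective (P := P) t
  obtain ⟨Z, z, f, h, rfl, rfl⟩ := exists_map_eq_and_map_eq x y
  rw [← Φ.toPresheafFiber_w_apply] at ht ⊢
  generalize P.map h.op s = s at ht ⊢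
  obtain ⟨φ, hφ⟩ := exists_mulActionHom_apply_eq ht
  have hφz (g : FundamentalGroup Φ.fiber) :
      Φ.toPresheafFiber Z (g • z) P s = φ (Φ.fiber.map f (g • z)) := by
    rw [FundamentalGroup.map_smul, map_smul, hφ, smul_toPresheafFiber_apply]
  obtain ⟨s', rfl⟩ := hJ.exists_map_eq hP f s fun {W} a b hab => by
    obtain ⟨w⟩ : Nonempty (Φ.fiber.obj W) := inferInstance
    obtain ⟨g, hg⟩ := MulAction.exists_smul_eq (FundamentalGroup Φ.fiber) z (Φ.fiber.map a w)
    obtain ⟨k, hk⟩ := MulAction.exists_smul_eq (FundamentalGroup Φ.fiber) z (Φ.fiber.map b w)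
    refine hJ.injective_toPresheafFiber hP Φ w ?_
    rw [Φ.toPresheafFiber_w_apply, Φ.toPresheafFiber_w_apply, ← hg, ← hk, hφz, hφz, hg, hk,
      ← Functor.map_comp_apply, hab, Functor.map_comp_apply]
  exact ⟨s', (Φ.toPresheafFiber_w_apply ..).symm⟩

theorem full_sheafFiberGSet : (sheafFiberGSet Φ).Full where
  map_surjective {F F'} φ := by
    let f : Φ.presheafFiber.obj F.obj → Φ.presheafFiber.obj F'.obj := φ.hom.hom
    have hf (g : FundamentalGroup Φ.fiber) (t) : f (g • t) = g • f t :=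
      ConcreteCategory.congr_hom (φ.hom.comm g) t
    have hF' := (isSheaf_iff_isSheaf_of_type J _).1 F'.property
    have hex (X : C) (s : F.obj.obj (op X)) : ∃ s' : F'.obj.obj (op X), ∀ x : Φ.fiber.obj X,
        Φ.toPresheafFiber X x F'.obj s' = f (Φ.toPresheafFiber X x F.obj s) := by
      obtain ⟨x⟩ : Nonempty (Φ.fiber.obj X) := inferInstance
      obtain ⟨s', hs'⟩ := exists_toPresheafFiber_apply_eq Φ hJ hF' x
        (t := f (Φ.toPresheafFiber X x F.obj s)) fun g hg => by
          rw [MulAction.mem_stabilizer_iff] at hg ⊢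
          rw [← hf, smul_toPresheafFiber_apply, hg]
      refine ⟨s', fun y => ?_⟩
      obtain ⟨g, rfl⟩ := MulAction.exists_smul_eq (FundamentalGroup Φ.fiber) x y
      rw [← smul_toPresheafFiber_apply, hs', ← hf, smul_toPresheafFiber_apply]
    choose α hα using hex
    refine ⟨ObjectProperty.homMk { app := fun X => ↾α X.unop, naturality := fun X Y p => ?_ }, ?_⟩
    · ext s
      obtain ⟨y⟩ : Nonempty (Φ.fiber.obj Y.unop) := inferInstance
      refine hJ.injective_toPresheafFiber hF' Φ y ?_
      change Φ.toPresheafFiber _ y F'.obj (α Y.unop (F.obj.map p.unop.op s)) =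
        Φ.toPresheafFiber _ y F'.obj (F'.obj.map p.unop.op (α X.unop s))
      rw [hα, Φ.toPresheafFiber_w_apply, Φ.toPresheafFiber_w_apply, hα]
    · ext t
      obtain ⟨X, x, s, rfl⟩ := Φ.toPresheafFiber_jointly_surjective (P := F.obj) t
      exact (Φ.toPresheafFiber_naturality_apply _ X x s).trans (hα X s x)

end

section EquivariantMaps

variable (S : Type w) [MulAction (FundamentalGroup Φ.fiber) S]

/-- The presheaf of equivariant maps from the fibres to a set `S`, whose fibre is `S` when the
action on `S` is continuous. -/
noncomputable def equivariantMaps : Cᵒᵖ ⥤ Type w where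
  obj X := Φ.fiber.obj X.unop →[FundamentalGroup Φ.fiber] S
  map f := ↾fun φ => φ.comp (FundamentalGroup.mapHom Φ.fiber f.unop)
  map_id _ := ConcreteCategory.hom_ext _ _ fun φ =>
    MulActionHom.ext fun x => congrArg φ (Functor.map_id_apply Φ.fiber _ x)
  map_comp f g := ConcreteCategory.hom_ext _ _ fun φ =>
    MulActionHom.ext fun x => congrArg φ (Functor.map_comp_apply Φ.fiber g.unop f.unop x)

theorem isSheaf_equivariantMaps [∀ {X Y : C} (f : X ⟶ Y), Epi f] (hJ : IsAtomicTopology J) :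
    Presieve.IsSheaf J (equivariantMaps Φ S) := by
  refine hJ.isSheaf_iff.2 fun {X Y} f => Presieve.isSheafFor_singleton.2 fun φ hφ => ?_
  refine existsUnique_mulActionHom_comp_eq (φ := φ)
    (surjective_fiber_map Φ (hJ.coveringMorphisms f)) fun y y' h => ?_
  obtain ⟨Z, z, a, b, rfl, rfl⟩ := exists_map_eq_and_map_eq y y'
  have hab : a ≫ f = b ≫ f := eq_of_map_apply_eq (x := z) <| by
    rw [Functor.map_comp_apply, Functor.map_comp_apply]
    exact h
  exact DFunLike.congr_fun (F := Φ.fiber.obj Z →[FundamentalGroup Φ.fiber] S) (hφ a b hab) z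

/-- Evaluation of the germs of equivariant maps. -/
noncomputable def evalEquivariantMaps : Φ.presheafFiber.obj (equivariantMaps Φ S) ⟶ S :=
  Φ.presheafFiberDesc (fun _ x => ↾fun φ => φ.1 x) fun _ _ _ _ => rfl

theorem evalEquivariantMaps_toPresheafFiber {X : C} (x : Φ.fiber.obj X)
    (φ : Φ.fiber.obj X →[FundamentalGroup Φ.fiber] S) :
    evalEquivariantMaps Φ S (Φ.toPresheafFiber X x (equivariantMaps Φ S) φ) = φ x :=
  ConcreteCategory.congr_hom (Φ.toPresheafFiber_presheafFiberDesc (P := equivariantMaps Φ S)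
    (fun _ x => ↾fun φ => φ.1 x) _ X x) φ

theorem evalEquivariantMaps_smul (g : FundamentalGroup Φ.fiber)
    (t : Φ.presheafFiber.obj (equivariantMaps Φ S)) :
    evalEquivariantMaps Φ S (g • t) = g • evalEquivariantMaps Φ S t := by
  obtain ⟨X, x, (φ : Φ.fiber.obj X →[FundamentalGroup Φ.fiber] S), rfl⟩ :=
    Φ.toPresheafFiber_jointly_surjective (P := equivariantMaps Φ S) t
  calc
    _ = evalEquivariantMaps Φ S (Φ.toPresheafFiber X (g • x) (equivariantMaps Φ S) φ) :=
      congrArg _ (smul_toPresheafFiber_apply (P := equivariantMaps Φ S) Φ g x φ)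
    _ = φ (g • x) := evalEquivariantMaps_toPresheafFiber Φ S (g • x) φ
    _ = g • φ x := map_smul φ g x
    _ = _ := congrArg (g • ·) (evalEquivariantMaps_toPresheafFiber Φ S x φ).symm

variable [∀ X, MulAction.IsPretransitive (FundamentalGroup Φ.fiber) (Φ.fiber.obj X)]

theorem injective_evalEquivariantMaps : Function.Injective (evalEquivariantMaps Φ S) := by
  intro t t' h
  obtain ⟨X, x, (φ : Φ.fiber.obj X →[FundamentalGroup Φ.fiber] S),
      (ψ : Φ.fiber.obj X →[FundamentalGroup Φ.fiber] S), rfl, rfl⟩ :=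
    Φ.toPresheafFiber_jointly_surjective₂ (P := equivariantMaps Φ S) t t'
  replace h : φ x = ψ x := (evalEquivariantMaps_toPresheafFiber Φ S x φ).symm.trans
    (h.trans (evalEquivariantMaps_toPresheafFiber Φ S x ψ))
  refine congrArg _ (MulActionHom.ext fun y => ?_)
  obtain ⟨g, rfl⟩ := MulAction.exists_smul_eq (FundamentalGroup Φ.fiber) x y
  rw [map_smul, map_smul, h]

theorem surjective_evalEquivariantMaps
    (hS : ∀ s : S, IsOpen (MulAction.stabilizer (FundamentalGroup Φ.fiber) s :
      Set (FundamentalGroup Φ.fiber))) :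
    Function.Surjective (evalEquivariantMaps Φ S) := fun s => by
  obtain ⟨X, x, hx⟩ :=
    FundamentalGroup.exists_stabilizer_subset ((hS s).mem_nhds (one_mem _))
  obtain ⟨φ, rfl⟩ := exists_mulActionHom_apply_eq (SetLike.coe_subset_coe.1 hx)
  exact ⟨_, evalEquivariantMaps_toPresheafFiber Φ S x φ⟩

end EquivariantMaps

variable [∀ {X Y : C} (f : X ⟶ Y), Epi f]
  [∀ X, MulAction.IsPretransitive (FundamentalGroup Φ.fiber) (Φ.fiber.obj X)]
  (hJ : IsAtomicTopology J)

include hJ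

theorem essSurj_sheafFiberGSet : (sheafFiberGSet Φ).EssSurj where
  mem_essImage S := by
    let _ : MulAction (FundamentalGroup Φ.fiber) S.obj.V :=
      inferInstanceAs (MulAction _ (ToType S.obj))
    let e : Φ.presheafFiber.obj (equivariantMaps Φ S.obj.V) ≃ S.obj.V :=
      Equiv.ofBijective _ ⟨injective_evalEquivariantMaps Φ S.obj.V,
        surjective_evalEquivariantMaps Φ S.obj.V ((isContinuousDiscrete_iff _).1 S.property)⟩
    exact ⟨⟨equivariantMaps Φ S.obj.V, (isSheaf_iff_isSheaf_of_type J _).2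
      (isSheaf_equivariantMaps Φ _ hJ)⟩,
      ⟨ObjectProperty.isoMk _ (Action.mkIso e.toIso fun g => by
        ext t
        exact evalEquivariantMaps_smul Φ S.obj.V g t)⟩⟩

theorem isEquivalence_sheafFiberGSet [∀ X, Nonempty (Φ.fiber.obj X)] :
    (sheafFiberGSet Φ).IsEquivalence where
  faithful := faithful_sheafFiberGSet Φ hJ
  full := full_sheafFiberGSet Φ hJ
  essSurj := essSurj_sheafFiberGSet Φ hJ

end FibresOfSheaves

section FiniteGaloisObjects

universe w

/-- An object `A` is finite Galois if its automorphism group is finite and acts transitively on the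
morphisms to `A` from any other object. -/
structure IsFiniteGalois {D : Type u} [Category.{v} D] (A : D) : Prop where
  finite_aut : Finite (Aut A)
  exists_comp_hom_eq : ∀ ⦃Z : D⦄ (a b : Z ⟶ A), ∃ σ : Aut A, a ≫ σ.hom = b

/-- Every object of `D` receives a morphism from a finite Galois object. -/
def HasEnoughFiniteGaloisObjects (D : Type u) [Category.{v} D] : Prop :=
  ∀ A : D, ∃ B : D, IsFiniteGalois B ∧ Nonempty (B ⟶ A)

variable {D : Type u} [Category.{v} D] [∀ {A B : D} (f : A ⟶ B), Epi f]

theorem IsFiniteGalois.exists_hom_comp_eq {A : D} (hA : IsFiniteGalois A)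
    (hD : GrothendieckTopology.RightOreCondition D) {B : D} (f g : A ⟶ B) :
    ∃ σ : Aut A, σ.hom ≫ g = f := by
  obtain ⟨Z, a, b, hab⟩ := hD f g
  obtain ⟨σ, rfl⟩ := hA.exists_comp_hom_eq a b
  exact ⟨σ, ((cancel_epi a).1 (hab.trans (Category.assoc ..))).symm⟩

theorem exists_functor_obj_eq {ι : Type*} [Preorder ι] [IsCodirectedOrder ι] [Nonempty ι]
    (d : ι → D) (hd : ∀ i, IsFiniteGalois (d i))
    (hle : ∀ {i j : ι}, i ≤ j → Nonempty (d i ⟶ d j)) : ∃ F : ι ⥤ D, F.obj = d := by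
  -- The transition maps are those compatible, along an ultrafilter tending to `-∞`, with an
  -- arbitrary choice of morphisms `t`.
  let t {i j : ι} (h : i ≤ j) : d i ⟶ d j := (hle h).some
  let U : Ultrafilter ι := .of Filter.atBot
  let Compatible {i j : ι} (m : d i ⟶ d j) (k : ι) : Prop :=
    ∃ (hi : k ≤ i) (hj : k ≤ j), t hi ≫ m = t hj
  have eventually_le (i : ι) : ∀ᶠ k in U, k ≤ i :=
    Ultrafilter.of_le _ (Filter.eventually_le_atBot i)
  have exists_compatible {i j : ι} (h : i ≤ j) : ∃ m : d i ⟶ d j, ∀ᶠ k in U, Compatible m k := by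
    have := (hd j).finite_aut
    have : ∀ᶠ k in U, ∃ σ : Aut (d j), Compatible (t h ≫ σ.hom) k := by
      filter_upwards [eventually_le i] with k hk
      obtain ⟨σ, hσ⟩ := (hd j).exists_comp_hom_eq (t hk ≫ t h) (t (hk.trans h))
      exact ⟨σ, hk, hk.trans h, (Category.assoc ..).symm.trans hσ⟩
    obtain ⟨σ, hσ⟩ := Ultrafilter.eventually_exists_iff.1 this
    exact ⟨_, hσ⟩
  have eq_of_compatible {i j : ι} {m m' : d i ⟶ d j} (hm : ∀ᶠ k in U, Compatible m k)
      (hm' : ∀ᶠ k in U, Compatible m' k) : m = m' := by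
    obtain ⟨k, ⟨hi, hj, h⟩, _, _, h'⟩ := (hm.and hm').exists
    exact (cancel_epi (t hi)).1 (h.trans h'.symm)
  choose m hm using @exists_compatible
  refine ⟨{ obj := d, map := fun f => m f.le, map_id := fun i => ?_, map_comp := ?_ }, rfl⟩
  · refine eq_of_compatible (hm _) ?_
    filter_upwards [eventually_le i] with k hk using ⟨hk, hk, Category.comp_id _⟩
  · intro i j l f g
    refine eq_of_compatible (hm _) ?_
    filter_upwards [hm f.le, hm g.le] with k ⟨hi, _, hf⟩ ⟨_, hl, hg⟩
    exact ⟨hi, hl, by rw [← Category.assoc, hf, hg]⟩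

theorem exists_functor_isFiniteGalois [EssentiallySmall.{w} D] [Nonempty D]
    (hD : HasEnoughFiniteGaloisObjects D)
    (hD' : ∀ A B : D, ∃ E : D, Nonempty (E ⟶ A) ∧ Nonempty (E ⟶ B)) :
    ∃ (ι : Type u) (_ : Preorder ι) (_ : Small.{w} ι) (_ : IsCofiltered ι) (F : ι ⥤ D),
      (∀ i, IsFiniteGalois (F.obj i)) ∧ ∀ A, ∃ i, Nonempty (F.obj i ⟶ A) := by
  let ι := {a : ThinSkeleton D // ∃ A, IsFiniteGalois A ∧ ThinSkeleton.mk A = a}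
  choose d hd hd' using fun i : ι => i.2
  have : Small.{w} (ThinSkeleton D) := small_skeleton_of_essentiallySmall D
  have le_iff {i j : ι} : i ≤ j ↔ Nonempty (d i ⟶ d j) := by
    rw [← Subtype.coe_le_coe, ← hd' i, ← hd' j]
    exact Iff.rfl
  have exists_hom (A : D) : ∃ i, Nonempty (d i ⟶ A) := by
    obtain ⟨B, hB, ⟨f⟩⟩ := hD A
    have hle : ThinSkeleton.mk (d ⟨_, B, hB, rfl⟩) ≤ ThinSkeleton.mk B := (hd' _).le
    exact ⟨_, hle.elim fun g => ⟨g ≫ f⟩⟩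
  have : Nonempty ι := ⟨(exists_hom (Classical.arbitrary D)).choose⟩
  have : IsCodirectedOrder ι := ⟨fun i j => by
    obtain ⟨E, ⟨f⟩, ⟨g⟩⟩ := hD' (d i) (d j)
    obtain ⟨k, ⟨h⟩⟩ := exists_hom E
    exact ⟨k, le_iff.2 ⟨h ≫ f⟩, le_iff.2 ⟨h ≫ g⟩⟩⟩
  obtain ⟨F, rfl⟩ := exists_functor_obj_eq d hd le_iff.1
  exact ⟨ι, inferInstance, inferInstance, inferInstance, F, hd, exists_hom⟩

end FiniteGaloisObjects

section Points

universe w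

variable {C : Type u} [Category.{v} C]

theorem rightOreCondition_over (hC : GrothendieckTopology.RightOreCondition C) (X₀ : C) :
    GrothendieckTopology.RightOreCondition (Over X₀) := fun {_ A B} f g => by
  obtain ⟨W, a, b, hab⟩ := hC f.left g.left
  refine ⟨Over.mk (a ≫ A.hom), Over.homMk a rfl, Over.homMk b ?_, Over.OverMorphism.ext hab⟩
  calc
    b ≫ B.hom = (b ≫ g.left) ≫ _ := by rw [Category.assoc, Over.w]
    _ = a ≫ A.hom := by rw [← hab, Category.assoc, Over.w]

theorem IsGaloisCovering.isFiniteGalois {X Y : C} {f : Y ⟶ X} (hf : IsGaloisCovering f)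
    (hfin : Finite (Aut (Over.mk f))) : IsFiniteGalois (Over.mk f) where
  finite_aut := hfin
  exists_comp_hom_eq Z a b := by
    obtain ⟨G, _, ρ, hρ⟩ := hf
    let := homAction f ρ Z.left
    obtain ⟨g, hg⟩ := (hρ Z.left).injective b.left a.left ((Over.w b).trans (Over.w a).symm)
    exact ⟨ρ g, Over.OverMorphism.ext hg⟩

variable {J : GrothendieckTopology C}

theorem IsYSite.hasEnoughFiniteGaloisObjects_over (hY : IsYSite J) (hJ : IsAtomicTopology J)
    {X₀ : C} (hfin : ∀ ⦃Y : C⦄ (f : Y ⟶ X₀), IsGaloisCovering f → Finite (Aut (Over.mk f))) :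
    HasEnoughFiniteGaloisObjects (Over X₀) := fun A => by
  have hA : saturation (coveringMorphisms J) A.hom := ⟨_, 𝟙 _, hJ.coveringMorphisms _⟩
  rw [← hY.enoughGalois] at hA
  obtain ⟨Y, g, hg⟩ := hA
  exact ⟨_, hg.isFiniteGalois (hfin _ hg), ⟨Over.homMk g⟩⟩

variable [∀ {X Y : C} (f : X ⟶ Y), Epi f]

theorem hasFiniteFibresOver_of_hasEnoughFiniteGaloisObjects {ω : C ⥤ Type w}
    [IsCofiltered ω.Elements] (hsurj : ∀ {X Y : C} (f : X ⟶ Y), Function.Surjective (ω.map f))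
    {X₀ : C} (hX₀ : HasEnoughFiniteGaloisObjects (Over X₀)) : HasFiniteFibresOver ω X₀ := by
  intro Y f x
  obtain ⟨A, hA, ⟨h⟩⟩ := hX₀ (Over.mk f)
  have := hA.finite_aut
  obtain ⟨a, ha⟩ := hsurj A.hom x
  refine (Set.finite_range fun σ : Aut A => ω.map (σ.hom.left ≫ h.left) a).subset ?_
  rintro y rfl
  obtain ⟨b, rfl⟩ := hsurj h.left y
  obtain ⟨Z, z, p, q, rfl, rfl⟩ := exists_map_eq_and_map_eq a b
  have hpq : p ≫ A.hom = q ≫ A.hom := eq_of_map_apply_eq (x := z) (by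
    rw [Functor.map_comp_apply, ha, Functor.map_comp_apply, ← Over.w h, Functor.map_comp_apply]
    rfl)
  obtain ⟨σ, hσ⟩ := hA.exists_comp_hom_eq (Over.homMk p : Over.mk (p ≫ A.hom) ⟶ A)
    (Over.homMk q hpq.symm)
  have hσ' : p ≫ σ.hom.left = q := congrArg CommaMorphism.left hσ
  exact ⟨σ, by simp [← hσ']⟩

theorem IsAtomicTopology.nonempty_point [EssentiallySmall.{w} C] (hJ : IsAtomicTopology J)
    {X₀ : C} (hX₀ : HasEnoughFiniteGaloisObjects (Over X₀)) :
    Nonempty (GrothendieckTopology.Point.{w} J) := by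
  have : Nonempty (Over X₀) := ⟨Over.mk (𝟙 X₀)⟩
  have (A B : Over X₀) (f : A ⟶ B) : Epi f := Over.epi_of_epi_left f
  have : EssentiallySmall.{w} (Over X₀) := CostructuredArrow.essentiallySmall
  have hOre : GrothendieckTopology.RightOreCondition (Over X₀) :=
    rightOreCondition_over hJ.rightOreCondition X₀
  obtain ⟨ι, _, _, _, F, hF, hF'⟩ := exists_functor_isFiniteGalois.{v, max u v, w} hX₀ fun A B => by
    obtain ⟨E, f, g, -⟩ := hOre (Over.mkIdTerminal.from A) (Over.mkIdTerminal.from B)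
    exact ⟨E, ⟨f⟩, ⟨g⟩⟩
  have : EssentiallySmall.{w} ι := essentiallySmall_of_small_of_locallySmall _
  have : InitiallySmall.{w} ι := initiallySmall_of_essentiallySmall ι
  refine ⟨.ofIsCofiltered (F ⋙ Over.forget X₀) fun {X} R hR i (f : (F.obj i).left ⟶ X) => ?_⟩
  obtain ⟨Y, g, hg⟩ := hJ.mem_iff.1 hR
  obtain ⟨Z, a, b, hab⟩ := hJ.rightOreCondition g f
  let b' : Over.mk (b ≫ (F.obj i).hom) ⟶ F.obj i := Over.homMk b
  obtain ⟨j, ⟨c⟩⟩ := hF' (Over.mk (b ≫ (F.obj i).hom))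
  let p := IsCofiltered.minToLeft i j
  let q := IsCofiltered.minToRight i j
  obtain ⟨σ, hσ⟩ := (hF _).exists_hom_comp_eq hOre (F.map p) (F.map q ≫ c ≫ b')
  refine ⟨Y, g, hg, _, p, σ.hom.left ≫ (F.map q).left ≫ c.left ≫ a, ?_⟩
  calc
    _ = (σ.hom ≫ F.map q ≫ c ≫ b').left ≫ f := by simp [b', hab]
    _ = _ := by rw [hσ]; rfl

end Points

theorem exists_isTerminal_of_hasTerminal (C : Type u) [Category.{v} C] [Nonempty C] :
    ∃ X₀ : C, Limits.HasTerminal C → Nonempty (Limits.IsTerminal X₀) := by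
  by_cases h : Limits.HasTerminal C
  · exact ⟨⊤_ C, fun _ => ⟨Limits.terminalIsTerminal⟩⟩
  · exact ⟨Classical.arbitrary C, fun h' => (h h').elim⟩

theorem finite_aut_over {C : Type u} [Category.{v} C] {X₀ : C} (A : Over X₀)
    [Finite (A.left ⟶ A.left)] : Finite (Aut A) :=
  .of_injective (fun σ => σ.hom.left) fun _ _ h => Iso.ext (Over.OverMorphism.ext h)

end YSites

theorem theorem9p1_general {C : Type u} [Category.{v} C] (J : GrothendieckTopology C)
    (hY : YSites.IsYSite J) (hJ : YSites.IsAtomicTopology J) (X₀ : C)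
    (hfin : ∀ ⦃Y : C⦄ (f : Y ⟶ X₀), YSites.IsGaloisCovering f → Finite (Aut (Over.mk f))) :
    ∃ (G : Type v) (_ : Group G) (_ : TopologicalSpace G),
      YSites.IsLocallyProfiniteGroup G ∧
      Nonempty (Sheaf J (Type v) ≌ YSites.DiscreteGSet.{v} G) ∧
      (Limits.IsTerminal X₀ → YSites.IsProfiniteGroup G) := by
  have := hY.essentiallySmall
  have {X Y : C} (f : X ⟶ Y) : Epi f := hY.epi f
  have hX₀ := hY.hasEnoughFiniteGaloisObjects_over hJ hfin
  obtain ⟨Φ⟩ := hJ.nonempty_point hX₀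
  have hsurj {X Y : C} (f : X ⟶ Y) : Function.Surjective (Φ.fiber.map f) :=
    YSites.surjective_fiber_map Φ (hJ.coveringMorphisms f)
  have hfib := YSites.hasFiniteFibresOver_of_hasEnoughFiniteGaloisObjects hsurj hX₀
  have (X : C) : Nonempty (Φ.fiber.obj X) := YSites.nonempty_fiber_obj Φ hY.lambdaConnected X
  let x₀ : Φ.fiber.obj X₀ := Classical.arbitrary _
  have := YSites.FundamentalGroup.isPretransitive hsurj hfib x₀
  have hK := YSites.FundamentalGroup.isCompact_stabilizer hsurj hfib x₀
  have := YSites.isEquivalence_sheafFiberGSet Φ hJ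
  refine ⟨YSites.FundamentalGroup Φ.fiber, inferInstance, inferInstance,
    YSites.isLocallyProfiniteGroup_of_isCompact_of_isOpen hK
      (YSites.FundamentalGroup.isOpen_stabilizer x₀),
    ⟨(YSites.sheafFiberGSet Φ).asEquivalence⟩, fun hT => ?_⟩
  have := Φ.uniqueFiberObj X₀ hT
  have htop : MulAction.stabilizer (YSites.FundamentalGroup Φ.fiber) x₀ = ⊤ :=
    eq_top_iff.2 fun g _ => Subsingleton.elim (g • x₀) x₀
  rw [htop, Subgroup.coe_top, isCompact_univ_iff] at hK
  exact YSites.isProfiniteGroup_of_compactSpace _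

theorem theorem9p1 {C : Type u} [Category.{v} C] [Nonempty C] (J : GrothendieckTopology C)
    (hY : YSites.IsYSite J) (hJ : YSites.IsAtomicTopology J)
    (hfin : ∀ X Y : C, Finite (X ⟶ Y)) :
    ∃ (G : Type v) (_ : Group G) (_ : TopologicalSpace G),
      YSites.IsLocallyProfiniteGroup G ∧
      Nonempty (Sheaf J (Type v) ≌ YSites.DiscreteGSet.{v} G) ∧
      (Limits.HasTerminal C → YSites.IsProfiniteGroup G) := by
  obtain ⟨X₀, hX₀⟩ := YSites.exists_isTerminal_of_hasTerminal C
  obtain ⟨G, _, _, hG, hJG, hG'⟩ := theorem9p1_general J hY hJ X₀ fun _ _ _ =>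
    YSites.finite_aut_over _
  exact ⟨G, _, _, hG, hJG, fun h => (hX₀ h).elim hG'⟩
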